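/- Consider a generalized linear model with $d$ explanatory variables $x\in\Omega\subseteq\mathbb{R}^d$ ($\Omega$ measurable), basis functions $g=(g_1,\dots,g_l)^T$, coefficient vector $\beta\in\mathbb{R}^l$ and link function $h$, so that the response $Y(x)$ has mean $\mu(x)=h^{-1}(\eta(x))$ with $\eta(x)=\beta^Tg(x)$ and a finite positive variance for every $x\in\Omega$. Here $h$ is a homeomorphism between open subsets of $\mathbb{R}$, $\eta(x)$ lies in the domain of $h^{-1}$, and $h$ is differentiable at $\mu(x)$ with $h'(\mu(x))\neq 0$, for every $x\in\Omega$. Put $w(x)=1/\{\mathrm{Var}(Y(x))\,[h'(\mu(x))]^2\}$. Fix distinct design points $x_1,\dots,x_n\in\Omega$. For a weight vector $\lambda=(\lambda_1,\dots,\lambda_n)$ with $\lambda_i\ge 0$ and $\sum_i\lambda_i=1$ let $$I(\xi^\lambda)=\sum_{i=1}^n\lambda_i\,w(x_i)\,g(x_i)g(x_i)^T$$ be the Fisher information matrix, and call $\lambda$ feasible if $I(\xi^\lambda)$ is nonsingular. Let $\lambda^*$ be a feasible weight vector. (i) Let $q\ge 1$, let $f:\mathbb{R}^l\to\mathbb{R}^q$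 be differentiable at $\beta$ with Jacobian matrix $K=\partial f(\beta)/\partial\beta^T\in\mathbb{R}^{q\times l}$, let $B=K^TK$, let $0<p<\infty$, and let $$\Phi_p(\xi^\lambda)=\left(q^{-1}\,\mathrm{tr}\left[\left(K\,I(\xi^\lambda)^{-1}K^T\right)^p\right]\right)^{1/p}.$$ Real powers of a diagonalizable matrix $N=P\,\mathrm{diag}(d_i)P^{-1}$ with all $d_i\ge 0$ are $N^s=P\,\mathrm{diag}(d_i^s)P^{-1}$, with the convention $0^s=0$ for $s<0$ and $0^0=1$. If for all $i=1,\dots,n$ $$\Phi_p(\xi^{\lambda^*})=q^{-1/p}\left[\mathrm{tr}\left(\left(I(\xi^{\lambda^*})^{-1}B\right)^p\right)\right]^{1/p-1}w(x_i)\,g(x_i)^TI(\xi^{\lambda^*})^{-1}B\left(I(\xi^{\lambda^*})^{-1}B\right)^{p-1}I(\xi^{\lambda^*})^{-1}g(x_i),$$ then $\lambda^*$ minimizes $\Phi_p(\xi^\lambda)$ over all feasible weight vectors $\lambda$. (ii) Let $\nu$ be a probability measure on $\mathbb{R}^d$, let $c(x)=g(x)\,\frac{\mathrm{d}h^{-1}}{\mathrm{d}\eta}(\eta(x))$,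 suppose that the entries of $c\,c^T$ are $\nu$-integrable over $\Omega$, let $A=\int_\Omega c(x)c(x)^T\,\mathrm{d}\nu(x)$, and let $\mathrm{EI}(\xi^\lambda)=\mathrm{tr}\left(A\,I(\xi^\lambda)^{-1}\right)$. If for all $i=1,\dots,n$ $$\mathrm{tr}\left(I(\xi^{\lambda^*})^{-1}A\right)=w(x_i)\,g(x_i)^TI(\xi^{\lambda^*})^{-1}A\,I(\xi^{\lambda^*})^{-1}g(x_i),$$ then $\lambda^*$ minimizes $\mathrm{EI}(\xi^\lambda)$ over all feasible weight vectors $\lambda$. -/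

import Mathlib

open MeasureTheory ProbabilityTheory Matrix

/-- Real power `N ^ s` of a square matrix that is diagonalizable over `ℝ` with nonnegative
eigenvalues (for instance a positive semidefinite matrix, or a product of a positive definite and a
positive semidefinite matrix): the polynomial in `N` that interpolates `t ↦ t ^ s` on the set of
eigenvalues of `N`. By `matrixRpow_conj` it is the usual power `P diag(dᵢ ^ s) P⁻¹` of
`N = P diag(dᵢ) P⁻¹`. -/
noncomputable def matrixRpow {ι : Type*} [Fintype ι] [DecidableEq ι]
    (N : Matrix ι ι ℝ) (s : ℝ) : Matrix ι ι ℝ :=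
  Polynomial.aeval N
    (Lagrange.interpolate N.charpoly.roots.toFinset id (fun t : ℝ => t ^ s))

theorem matrixRpow_conj {ι : Type*} [Fintype ι] [DecidableEq ι]
    (P : Matrix ι ι ℝ) (hP : IsUnit P.det) (e : ι → ℝ) (s : ℝ) :
    matrixRpow (P * diagonal e * P⁻¹) s = P * diagonal (fun i => e i ^ s) * P⁻¹ := by
  obtain ⟨u, rfl⟩ := (Matrix.isUnit_iff_isUnit_det P).2 hP
  rw [← Matrix.coe_units_inv]
  have hchar : ((u : Matrix ι ι ℝ) * diagonal e * (↑u⁻¹ : Matrix ι ι ℝ)).charpoly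
      = ∏ i, (Polynomial.X - Polynomial.C (e i)) := by
    rw [Matrix.coe_units_inv, Matrix.charpoly_units_conj, Matrix.charpoly_diagonal]
  have hconj : ∀ r : Polynomial ℝ,
      Polynomial.aeval ((u : Matrix ι ι ℝ) * diagonal e * (↑u⁻¹ : Matrix ι ι ℝ)) r
        = (u : Matrix ι ι ℝ) * diagonal (fun i => r.eval (e i)) * (↑u⁻¹ : Matrix ι ι ℝ) := by
    intro r
    induction r using Polynomial.induction_on' with
    | add a b ha hb =>
      simp only [map_add, ha, hb, Polynomial.eval_add]
      rw [← Matrix.add_mul, ← Matrix.mul_add, Matrix.diagonal_add]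
    | monomial k a =>
      rw [Polynomial.aeval_monomial, Units.conj_pow, Matrix.diagonal_pow,
        Algebra.algebraMap_eq_smul_one, smul_mul_assoc, one_mul, ← smul_mul_assoc,
        ← mul_smul_comm, ← Matrix.diagonal_smul]
      simp only [Polynomial.eval_monomial]
      rfl
  rw [matrixRpow, hconj]
  congr 3
  funext i
  have hi : e i ∈ ((u : Matrix ι ι ℝ) * diagonal e *
      (↑u⁻¹ : Matrix ι ι ℝ)).charpoly.roots.toFinset := by
    rw [Multiset.mem_toFinset, hchar, Polynomial.mem_roots
      (Finset.prod_ne_zero_iff.2 fun j _ => Polynomial.X_sub_C_ne_zero (e j)),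
      Polynomial.IsRoot, Polynomial.eval_prod]
    exact Finset.prod_eq_zero (Finset.mem_univ i) (by simp)
  exact Lagrange.eval_interpolate_at_node _ (Set.injOn_id _) hi

/-- A generalized linear model with `d` explanatory variables and `l` basis functions, at a given
value `β` of the regression coefficients. The link function `h` is a bijection `link` between an
open set of means and an open set of linear predictors, with inverse `link.symm`. The response at
`x` has law `law x`; of the exponential family to which it belongs, only the mean and the variance
matter here, so no particular form of the law is imposed. -/
structure GLModel (d l : ℕ) where
  /-- the experimental region -/
  region : Set (Fin d → ℝ)
  measurableSet_region : MeasurableSet region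
  /-- the basis functions -/
  g : (Fin d → ℝ) → Fin l → ℝ
  /-- the regression coefficients -/
  β : Fin l → ℝ
  /-- the link function `h` -/
  link : OpenPartialHomeomorph ℝ ℝ
  /-- the law of the response `Y(x)` -/
  law : (Fin d → ℝ) → Measure ℝ
  linPred_mem : ∀ x ∈ region, β ⬝ᵥ g x ∈ link.target
  differentiableAt_link : ∀ x ∈ region, DifferentiableAt ℝ link (link.symm (β ⬝ᵥ g x))
  deriv_link_ne_zero : ∀ x ∈ region, deriv link (link.symm (β ⬝ᵥ g x)) ≠ 0
  isProbabilityMeasure_law : ∀ x ∈ region, IsProbabilityMeasure (law x)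
  memLp_law : ∀ x ∈ region, MemLp id 2 (law x)
  mean_law : ∀ x ∈ region, ∫ y, y ∂(law x) = link.symm (β ⬝ᵥ g x)
  variance_law_pos : ∀ x ∈ region, 0 < variance id (law x)

namespace GLModel

variable {d l n : ℕ} (M : GLModel d l)

/-- The linear predictor `η(x) = βᵀ g(x)`. -/
noncomputable def linPred (x : Fin d → ℝ) : ℝ := M.β ⬝ᵥ M.g x

/-- The mean response `μ(x) = h⁻¹(βᵀ g(x))`. -/
noncomputable def mean (x : Fin d → ℝ) : ℝ := M.link.symm (M.linPred x)

/-- `w(x) = 1 / (Var(Y(x)) h'(μ(x))²)`. -/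
noncomputable def w (x : Fin d → ℝ) : ℝ :=
  1 / (variance id (M.law x) * deriv M.link (M.mean x) ^ 2)

/-- The Fisher information matrix `I(ξ) = ∑ᵢ λᵢ w(xᵢ) g(xᵢ) g(xᵢ)ᵀ` of the design `ξ` with points
`x i` and weights `lam i`. -/
noncomputable def fisherInfo (x : Fin n → Fin d → ℝ) (lam : Fin n → ℝ) :
    Matrix (Fin l) (Fin l) ℝ :=
  ∑ i, (lam i * M.w (x i)) • vecMulVec (M.g (x i)) (M.g (x i))

/-- The feasible weight vectors for given design points: nonnegative weights with sum `1` for which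
`I(ξ)⁻¹` exists. -/
def feasibleWeights (x : Fin n → Fin d → ℝ) : Set (Fin n → ℝ) :=
  {lam | lam ∈ stdSimplex ℝ (Fin n) ∧ IsUnit (M.fisherInfo x lam).det}

/-- The `q × l` Jacobian matrix `∂f(β)/∂βᵀ`. -/
noncomputable def jacobian {q : ℕ} (f : (Fin l → ℝ) → Fin q → ℝ) : Matrix (Fin q) (Fin l) ℝ :=
  Matrix.of fun i j => fderiv ℝ f M.β (Pi.single j 1) i

/-- `B = (∂f(β)/∂βᵀ)ᵀ (∂f(β)/∂βᵀ)`. -/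
noncomputable def matB {q : ℕ} (f : (Fin l → ℝ) → Fin q → ℝ) : Matrix (Fin l) (Fin l) ℝ :=
  (M.jacobian f)ᵀ * M.jacobian f

/-- The `Φ_p` criterion
`(q⁻¹ tr[((∂f(β)/∂βᵀ) I(ξ)⁻¹ (∂f(β)/∂βᵀ)ᵀ) ^ p]) ^ (1 / p)`. -/
noncomputable def phi {q : ℕ} (p : ℝ) (f : (Fin l → ℝ) → Fin q → ℝ)
    (x : Fin n → Fin d → ℝ) (lam : Fin n → ℝ) : ℝ :=
  ((q : ℝ)⁻¹ *
    (matrixRpow (M.jacobian f * (M.fisherInfo x lam)⁻¹ * (M.jacobian f)ᵀ) p).trace) ^ (1 / p)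

/-- `c(x) = g(x) (dh⁻¹/dη)`, the derivative being taken at the linear predictor `η(x)`. -/
noncomputable def c (x : Fin d → ℝ) (j : Fin l) : ℝ :=
  M.g x j * deriv M.link.symm (M.linPred x)

/-- `A = ∫_Ω c(x) c(x)ᵀ dν(x)`. -/
noncomputable def matA (ν : Measure (Fin d → ℝ)) : Matrix (Fin l) (Fin l) ℝ :=
  Matrix.of fun j k => ∫ x in M.region, M.c x j * M.c x k ∂ν

/-- The EI criterion `tr(A I(ξ)⁻¹)`. -/
noncomputable def EI (ν : Measure (Fin d → ℝ)) (x : Fin n → Fin d → ℝ) (lam : Fin n → ℝ) : ℝ :=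
  (M.matA ν * (M.fisherInfo x lam)⁻¹).trace

end GLModel

/-! The criteria are convex in the information matrix, in the form of a global tangent inequality.
Write `N = K M⁻¹ Kᵀ` and `N₀ = K M₀⁻¹ Kᵀ`. Then `tr N^p ≥ tr N₀^p + p (tr N₀^p - tr (N₀^(p-1) K M₀⁻¹
M M₀⁻¹ Kᵀ))`, and the bracket is linear in `M` up to a constant. The hypothesis at the design
points, averaged with the weights of any competitor, makes the bracket vanish
(`trace_mul_fisherInfo_of_forall_eq`).

The inequality is the heart of `trace_matrixRpow_le_of_gradient_le`: it reduces to the scalar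
tangent bound `rpow_tangent_le`, averaged over the squared overlaps of the eigenvectors of `N₀` and
`N`. For EI, expanding one positive semidefinite square suffices. -/

theorem Matrix.PosSemidef.exists_orthogonal_diagonalization {ι : Type*} [Fintype ι]
    [DecidableEq ι] {A : Matrix ι ι ℝ} (hA : A.PosSemidef) :
    ∃ (U : Matrix ι ι ℝ) (e : ι → ℝ), Uᵀ * U = 1 ∧ U * Uᵀ = 1 ∧ (∀ i, 0 ≤ e i) ∧
      A = U * diagonal e * Uᵀ := by
  refine ⟨hA.1.eigenvectorUnitary, hA.1.eigenvalues, ?_, ?_, hA.eigenvalues_nonneg, ?_⟩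
  · simpa [star_eq_conjTranspose] using Unitary.coe_star_mul_self hA.1.eigenvectorUnitary
  · simpa [star_eq_conjTranspose] using Unitary.coe_mul_star_self hA.1.eigenvectorUnitary
  · simpa [Unitary.conjStarAlgAut_apply, star_eq_conjTranspose, Function.comp_def] using
      hA.1.spectral_theorem

/-! ### Real powers of `S Kᵀ K` versus `K S Kᵀ`. -/

section MatrixRpow

variable {ι κ : Type*} [Fintype ι] [DecidableEq ι] [Fintype κ] [DecidableEq κ]

theorem aeval_conj_diagonal (P : Matrix ι ι ℝ) (hP : IsUnit P.det) (e : ι → ℝ)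
    (r : Polynomial ℝ) :
    Polynomial.aeval (P * diagonal e * P⁻¹) r = P * diagonal (fun i => r.eval (e i)) * P⁻¹ := by
  have h1 : P⁻¹ * P = 1 := Matrix.nonsing_inv_mul P hP
  have h2 : P * P⁻¹ = 1 := Matrix.mul_nonsing_inv P hP
  induction r using Polynomial.induction_on' with
  | add a b ha hb =>
    simp only [map_add, ha, hb, Polynomial.eval_add]
    rw [← Matrix.add_mul, ← Matrix.mul_add, Matrix.diagonal_add]
  | monomial k a =>
    have hpow : (P * diagonal e * P⁻¹) ^ k = P * diagonal (fun i => e i ^ k) * P⁻¹ := by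
      induction k with
      | zero => simp [h2]
      | succ k ih =>
        rw [pow_succ, ih]
        calc P * diagonal (fun i => e i ^ k) * P⁻¹ * (P * diagonal e * P⁻¹)
            = P * diagonal (fun i => e i ^ k) * (P⁻¹ * P) * diagonal e * P⁻¹ := by
              simp only [Matrix.mul_assoc]
          _ = P * (diagonal (fun i => e i ^ k) * diagonal e) * P⁻¹ := by
              rw [h1, Matrix.mul_one, Matrix.mul_assoc P]
          _ = _ := by simp [Matrix.diagonal_mul_diagonal, pow_succ]
    have hd : diagonal (fun i => a * e i ^ k) = a • diagonal (fun i => e i ^ k) := by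
      ext i j
      by_cases h : i = j <;> simp [h]
    simp only [Polynomial.aeval_monomial, hpow, Polynomial.eval_monomial, hd,
      Algebra.algebraMap_eq_smul_one, smul_mul_assoc, one_mul, Matrix.mul_smul]

/-- A real power agrees with every polynomial that takes the right values at the eigenvalues. -/
theorem matrixRpow_eq_aeval (P : Matrix ι ι ℝ) (hP : IsUnit P.det) (e : ι → ℝ) (s : ℝ)
    (r : Polynomial ℝ) (hr : ∀ i, r.eval (e i) = e i ^ s) :
    matrixRpow (P * diagonal e * P⁻¹) s = Polynomial.aeval (P * diagonal e * P⁻¹) r := by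
  rw [matrixRpow_conj P hP, aeval_conj_diagonal P hP]
  simp only [hr]

theorem matrixRpow_orthogonal_conj {U : Matrix ι ι ℝ} (hU : Uᵀ * U = 1) (e : ι → ℝ) (s : ℝ) :
    matrixRpow (U * diagonal e * Uᵀ) s = U * diagonal (fun i => e i ^ s) * Uᵀ := by
  have h := matrixRpow_conj U ((isUnit_iff_isUnit_det U).1 (IsUnit.of_mul_eq_one_right _ hU)) e s
  rwa [Matrix.inv_eq_left_inv hU] at h

theorem aeval_mul_swap (X : Matrix ι κ ℝ) (Y : Matrix κ ι ℝ) (r : Polynomial ℝ) :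
    Y * Polynomial.aeval (X * Y) r = Polynomial.aeval (Y * X) r * Y := by
  induction r using Polynomial.induction_on' with
  | add a b ha hb => simp only [map_add, Matrix.mul_add, Matrix.add_mul, ha, hb]
  | monomial k a =>
    have hpow : Y * (X * Y) ^ k = (Y * X) ^ k * Y := by
      induction k with
      | zero => simp
      | succ k ih =>
        rw [pow_succ, ← Matrix.mul_assoc, ih, pow_succ]
        simp only [Matrix.mul_assoc]
    simp only [Polynomial.aeval_monomial, Algebra.algebraMap_eq_smul_one, smul_mul_assoc, one_mul,
      Matrix.mul_smul, Matrix.smul_mul, hpow]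

/-- A product of a positive definite and a positive semidefinite matrix is diagonalizable. -/
theorem exists_diagonalization_posDef_mul {S B : Matrix ι ι ℝ} (hS : S.PosDef)
    (hB : B.PosSemidef) :
    ∃ (P : Matrix ι ι ℝ) (e : ι → ℝ), IsUnit P.det ∧ S * B = P * diagonal e * P⁻¹ := by
  obtain ⟨V, a, -, -, ha, hSV⟩ := hS.posSemidef.exists_orthogonal_diagonalization
  -- With `S = R Rᵀ` and `R` invertible, `S B` is similar to the symmetric matrix `Rᵀ B R`.
  set R := V * diagonal (fun i => √(a i)) with hR
  have hSR : S = R * Rᵀ := by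
    rw [hR, Matrix.transpose_mul, Matrix.diagonal_transpose, hSV]
    simp only [Matrix.mul_assoc]
    congr 1
    rw [← Matrix.mul_assoc, Matrix.diagonal_mul_diagonal]
    simp only [Real.mul_self_sqrt (ha _)]
  have hRu : IsUnit R.det := by
    have h := hS.det_pos
    rw [hSR, Matrix.det_mul, Matrix.det_transpose] at h
    exact isUnit_iff_ne_zero.2 fun h0 => by simp [h0] at h
  have hC : (Rᵀ * B * R).PosSemidef := by
    simpa using hB.conjTranspose_mul_mul_same R
  obtain ⟨U, e, hU, -, -, hCU⟩ := hC.exists_orthogonal_diagonalization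
  have hUu : IsUnit U.det :=
    (isUnit_iff_isUnit_det U).1 (IsUnit.of_mul_eq_one_right _ hU)
  refine ⟨R * U, e, by rw [Matrix.det_mul]; exact hRu.mul hUu, ?_⟩
  rw [Matrix.mul_inv_rev, Matrix.inv_eq_left_inv hU]
  calc S * B = R * (Rᵀ * B * R) * R⁻¹ := by
        rw [hSR]
        simp only [Matrix.mul_assoc, Matrix.mul_nonsing_inv R hRu, Matrix.mul_one]
    _ = _ := by rw [hCU]; simp only [Matrix.mul_assoc]

/-- A single interpolant on both spectra serves both powers, so polynomial identities between `XY`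
and `YX` transfer to real powers. The extra node `0` fixes the constant term. -/
theorem matrixRpow_posDef_mul_eq_aeval {S : Matrix ι ι ℝ} (hS : S.PosDef) (K : Matrix κ ι ℝ)
    (s : ℝ) : ∃ r : Polynomial ℝ, r.eval 0 = 0 ^ s ∧
      matrixRpow (S * (Kᵀ * K)) s = Polynomial.aeval (S * Kᵀ * K) r ∧
      matrixRpow (K * S * Kᵀ) s = Polynomial.aeval (K * (S * Kᵀ)) r := by
  have hB : (Kᵀ * K).PosSemidef := by simpa using posSemidef_conjTranspose_mul_self K
  have hN : (K * S * Kᵀ).PosSemidef := by simpa using hS.posSemidef.mul_mul_conjTranspose_same K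
  obtain ⟨P, e, hP, he⟩ := exists_diagonalization_posDef_mul hS hB
  obtain ⟨U, a, hU, -, -, hNU⟩ := hN.exists_orthogonal_diagonalization
  have hUu : IsUnit U.det :=
    (isUnit_iff_isUnit_det U).1 (IsUnit.of_mul_eq_one_right _ hU)
  classical
  set F : Finset ℝ := insert 0 (Finset.univ.image e ∪ Finset.univ.image a) with hF
  have hev : ∀ t ∈ F, (Lagrange.interpolate F id (fun t : ℝ => t ^ s)).eval t = t ^ s :=
    fun t ht => Lagrange.eval_interpolate_at_node (v := id) _ (Set.injOn_id _) ht
  refine ⟨_, hev 0 (by simp [hF]), ?_, ?_⟩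
  · rw [Matrix.mul_assoc S, he]
    exact matrixRpow_eq_aeval P hP e s _ fun i => hev _ (by simp [hF])
  · rw [← Matrix.mul_assoc K, hNU, ← Matrix.inv_eq_left_inv hU]
    exact matrixRpow_eq_aeval U hUu a s _ fun i => hev _ (by simp [hF])

/-- Since `s ≠ 0`, the interpolant is divisible by `X` and cyclicity of the trace applies. For `s =
0` the traces are the two matrix sizes. -/
theorem trace_matrixRpow_posDef_mul {S : Matrix ι ι ℝ} (hS : S.PosDef) (K : Matrix κ ι ℝ)
    {s : ℝ} (hs : s ≠ 0) :
    (matrixRpow (S * (Kᵀ * K)) s).trace = (matrixRpow (K * S * Kᵀ) s).trace := by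
  obtain ⟨r, h0, h1, h2⟩ := matrixRpow_posDef_mul_eq_aeval hS K s
  rw [Real.zero_rpow hs] at h0
  obtain ⟨r, rfl⟩ : Polynomial.X ∣ r :=
    Polynomial.X_dvd_iff.2 (by rwa [Polynomial.coeff_zero_eq_eval_zero])
  rw [h1, h2, map_mul, map_mul, Polynomial.aeval_X, Polynomial.aeval_X, Matrix.mul_assoc (S * Kᵀ),
    aeval_mul_swap, ← Matrix.mul_assoc (S * Kᵀ), Matrix.trace_mul_comm, ← Matrix.mul_assoc,
    Matrix.mul_assoc K]

/-- Here `Y r(XY) = r(YX) Y` is enough, with no condition on `r 0`, so the exponent `p - 1` may be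
zero or negative. -/
theorem posDef_mul_matrixRpow_mul {S : Matrix ι ι ℝ} (hS : S.PosDef) (K : Matrix κ ι ℝ) (s : ℝ) :
    S * (Kᵀ * K) * matrixRpow (S * (Kᵀ * K)) s * S =
      S * Kᵀ * matrixRpow (K * S * Kᵀ) s * K * S := by
  obtain ⟨r, -, h1, h2⟩ := matrixRpow_posDef_mul_eq_aeval hS K s
  rw [h1, h2, ← Matrix.mul_assoc S, Matrix.mul_assoc (S * Kᵀ) K, aeval_mul_swap]
  simp only [Matrix.mul_assoc]

theorem trace_matrixRpow_nonneg {A : Matrix ι ι ℝ} (hA : A.PosSemidef) (s : ℝ) :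
    0 ≤ (matrixRpow A s).trace := by
  obtain ⟨U, e, hU, -, he, rfl⟩ := hA.exists_orthogonal_diagonalization
  rw [matrixRpow_orthogonal_conj hU, Matrix.trace_mul_comm, ← Matrix.mul_assoc, hU,
    Matrix.one_mul, Matrix.trace_diagonal]
  exact Finset.sum_nonneg fun i _ => Real.rpow_nonneg (he i) s

end MatrixRpow

/-! ### Tangent inequalities for the two criteria. -/

/-- This is the tangent at `1/a` of the convex function `t ↦ t^(-p)`, evaluated at `1/b`. -/
theorem rpow_tangent_le {p a b : ℝ} (hp : 0 < p) (ha : 0 < a) (hb : 0 < b) :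
    a ^ p + p * (a ^ p - a ^ (p - 1) * a ^ 2 * b⁻¹) ≤ b ^ p := by
  have h1 : 1 + p * (1 - a / b) ≤ (b / a) ^ p := by
    have hlog : 1 - a / b ≤ Real.log (b / a) := by
      have h := Real.one_sub_inv_le_log_of_pos (div_pos hb ha)
      rwa [inv_div] at h
    have hexp := Real.add_one_le_exp (Real.log (b / a) * p)
    rw [← Real.rpow_def_of_pos (div_pos hb ha)] at hexp
    nlinarith [mul_le_mul_of_nonneg_left hlog hp.le]
  have h2 : a ^ (p - 1) * a ^ 2 * b⁻¹ = a ^ p * (a / b) := by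
    rw [Real.rpow_sub_one ha.ne']
    field_simp
  have h3 : b ^ p = a ^ p * (b / a) ^ p := by
    rw [Real.div_rpow hb.le ha.le]
    field_simp [(Real.rpow_pos_of_pos ha p).ne']
  rw [h2, h3]
  nlinarith [mul_le_mul_of_nonneg_left h1 (Real.rpow_pos_of_pos ha p).le]

theorem trace_mul_gradient_comm {ι κ R : Type*} [Fintype ι] [Fintype κ] [CommRing R]
    (S M : Matrix ι ι R) (K : Matrix κ ι R) (T : Matrix κ κ R) :
    (T * (K * S * M * S * Kᵀ)).trace = (S * Kᵀ * T * K * S * M).trace := by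
  have h : S * Kᵀ * T * K * S * M = S * Kᵀ * (T * K * S * M) := by simp only [Matrix.mul_assoc]
  rw [h, Matrix.trace_mul_comm (S * Kᵀ)]
  simp only [Matrix.mul_assoc]

/-- A linear inequality at `M₀` for the power trace of `K M₀⁻¹ Kᵀ` implies a global comparison. -/
theorem trace_matrixRpow_le_of_gradient_le {ι κ : Type*} [Fintype ι] [DecidableEq ι] [Fintype κ]
    [DecidableEq κ] {M₀ M : Matrix ι ι ℝ} (hM₀ : M₀.PosDef) (hM : M.PosDef) (K : Matrix κ ι ℝ)
    {p : ℝ} (hp : 0 < p)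
    (hgrad : (matrixRpow (K * M₀⁻¹ * Kᵀ) (p - 1) * (K * M₀⁻¹ * M * M₀⁻¹ * Kᵀ)).trace ≤
      (matrixRpow (K * M₀⁻¹ * Kᵀ) p).trace) :
    (matrixRpow (K * M₀⁻¹ * Kᵀ) p).trace ≤ (matrixRpow (K * M⁻¹ * Kᵀ) p).trace := by
  have hN₀ : (K * M₀⁻¹ * Kᵀ).PosSemidef := by
    simpa using hM₀.inv.posSemidef.mul_mul_conjTranspose_same K
  have hN : (K * M⁻¹ * Kᵀ).PosSemidef := by
    simpa using hM.inv.posSemidef.mul_mul_conjTranspose_same K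
  obtain ⟨U, a, hU, hU', ha, hNU⟩ := hN₀.exists_orthogonal_diagonalization
  obtain ⟨V, b, hV, hV', hb, hNV⟩ := hN.exists_orthogonal_diagonalization
  have hMu : IsUnit M.det := isUnit_iff_ne_zero.2 hM.det_pos.ne'
  have hMit : (M⁻¹)ᵀ = M⁻¹ := by simpa using hM.inv.1.eq
  have hM₀it : (M₀⁻¹)ᵀ = M₀⁻¹ := by simpa using hM₀.inv.1.eq
  -- The squares `Q j k ^ 2` form a doubly stochastic matrix.
  set Q := Uᵀ * V with hQ
  set D := Uᵀ * (K * M₀⁻¹ * M * M₀⁻¹ * Kᵀ) * U with hD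
  have hVU : Vᵀ * U = Qᵀ := by rw [hQ, Matrix.transpose_mul, Matrix.transpose_transpose]
  have hQQ : Q * Qᵀ = 1 := by
    rw [← hVU, hQ, Matrix.mul_assoc, ← Matrix.mul_assoc V, hV', Matrix.one_mul, hU]
  have hQQ' : Qᵀ * Q = 1 := by
    rw [← hVU, hQ, Matrix.mul_assoc, ← Matrix.mul_assoc U, hU', Matrix.one_mul, hV]
  have hrow : ∀ j, ∑ k, Q j k ^ 2 = 1 := fun j => by
    have h := congrFun (congrFun hQQ j) j
    simpa [Matrix.mul_apply, sq] using h
  have hcol : ∀ k, ∑ j, Q j k ^ 2 = 1 := fun k => by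
    have h := congrFun (congrFun hQQ' k) k
    simpa [Matrix.mul_apply, sq] using h
  have hUN : Uᵀ * (K * M₀⁻¹ * Kᵀ) = diagonal a * Uᵀ := by
    rw [hNU, ← Matrix.mul_assoc, ← Matrix.mul_assoc, hU, Matrix.one_mul]
  have hdiagD : ∀ j, a j ^ 2 * ∑ k, Q j k ^ 2 * (b k)⁻¹ ≤ D j j := by
    intro j
    -- As `0⁻¹ = 0`, `W` is `Uᵀ N₀ N⁺ N₀ U` with `N⁺` the pseudoinverse of `N`.
    set W := diagonal a * Q * diagonal (fun k => (b k)⁻¹) * Qᵀ * diagonal a with hW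
    set Z := V * diagonal (fun k => (b k)⁻¹) * Qᵀ * diagonal a with hZ
    set Y := M₀⁻¹ * Kᵀ * U with hY
    have hZt : Zᵀ = diagonal a * Q * diagonal (fun k => (b k)⁻¹) * Vᵀ := by
      simp only [hZ, Matrix.transpose_mul, Matrix.diagonal_transpose, Matrix.transpose_transpose,
        Matrix.mul_assoc]
    have hYt : Yᵀ = Uᵀ * K * M₀⁻¹ := by
      simp only [hY, Matrix.transpose_mul, Matrix.transpose_transpose, hM₀it, Matrix.mul_assoc]
    have hYZ : Yᵀ * Kᵀ * Z = W := by
      have : Yᵀ * Kᵀ = diagonal a * Uᵀ := by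
        rw [hYt, ← hUN]; simp only [Matrix.mul_assoc]
      rw [this, hZ, hW, hQ]
      simp only [Matrix.mul_assoc]
    have hWt : Wᵀ = W := by
      simp only [hW, Matrix.transpose_mul, Matrix.diagonal_transpose, Matrix.transpose_transpose,
        Matrix.mul_assoc]
    have hZY : Zᵀ * K * Y = W := by
      rw [← hWt, ← hYZ]
      simp only [Matrix.transpose_mul, Matrix.transpose_transpose, Matrix.mul_assoc]
    have hZZ : Zᵀ * (K * M⁻¹ * Kᵀ) * Z = W := by
      have hdd : diagonal (fun k => (b k)⁻¹) * diagonal b * diagonal (fun k => (b k)⁻¹) =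
          diagonal (fun k => (b k)⁻¹) := by
        rw [Matrix.diagonal_mul_diagonal, Matrix.diagonal_mul_diagonal]
        congr 1
        funext k
        by_cases h : b k = 0
        · simp [h]
        · field_simp
      rw [hNV, hZt, hZ]
      calc _ = diagonal a * Q * diagonal (fun k => (b k)⁻¹) * (Vᵀ * V) * diagonal b * (Vᵀ * V) *
            diagonal (fun k => (b k)⁻¹) * Qᵀ * diagonal a := by simp only [Matrix.mul_assoc]
        _ = diagonal a * Q * (diagonal (fun k => (b k)⁻¹) * diagonal b *
            diagonal (fun k => (b k)⁻¹)) * Qᵀ * diagonal a := by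
            rw [hV]; simp only [Matrix.mul_assoc, Matrix.one_mul]
        _ = W := by rw [hdd]
    have hYY : Yᵀ * M * Y = D := by
      rw [hYt, hY, hD]; simp only [Matrix.mul_assoc]
    -- Completing the square in the `M`-form shows `D - W` is positive semidefinite.
    have hsq : (Y - M⁻¹ * Kᵀ * Z)ᵀ * M * (Y - M⁻¹ * Kᵀ * Z) = D - W := by
      have h1 : (M⁻¹ * Kᵀ * Z)ᵀ * M = Zᵀ * K := by
        simp only [Matrix.transpose_mul, Matrix.transpose_transpose, hMit, Matrix.mul_assoc,
          Matrix.nonsing_inv_mul M hMu, Matrix.mul_one]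
      have h2 : Yᵀ * M * (M⁻¹ * Kᵀ * Z) = Yᵀ * Kᵀ * Z := by
        simp only [← Matrix.mul_assoc]
        rw [Matrix.mul_assoc Yᵀ M, Matrix.mul_nonsing_inv M hMu, Matrix.mul_one]
      have h3 : Zᵀ * K * (M⁻¹ * Kᵀ * Z) = Zᵀ * (K * M⁻¹ * Kᵀ) * Z := by
        simp only [Matrix.mul_assoc]
      rw [Matrix.transpose_sub, Matrix.sub_mul, h1, Matrix.sub_mul, Matrix.mul_sub, Matrix.mul_sub,
        h2, h3, hYY, hYZ, hZY, hZZ]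
      abel
    have hpsd : ((Y - M⁻¹ * Kᵀ * Z)ᵀ * M * (Y - M⁻¹ * Kᵀ * Z)).PosSemidef := by
      simpa using hM.posSemidef.conjTranspose_mul_mul_same (Y - M⁻¹ * Kᵀ * Z)
    rw [hsq] at hpsd
    have h := hpsd.diag_nonneg (i := j)
    have hWj : W j j = a j ^ 2 * ∑ k, Q j k ^ 2 * (b k)⁻¹ := by
      rw [hW, Matrix.mul_diagonal, Matrix.mul_apply, Finset.sum_mul, Finset.mul_sum]
      refine Finset.sum_congr rfl fun k _ => ?_
      rw [Matrix.mul_diagonal, Matrix.diagonal_mul, Matrix.transpose_apply]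
      ring
    rw [Matrix.sub_apply, hWj] at h
    linarith
  -- `ker N = ker Kᵀ`, because `M⁻¹` is definite, and this lies in `ker N₀`.
  have hker : ∀ j k, b k = 0 → a j * Q j k = 0 := by
    intro j k hbk
    set v : κ → ℝ := fun i => V i k with hv
    have hNv : v ⬝ᵥ (K * M⁻¹ * Kᵀ) *ᵥ v = 0 := by
      have h : (Vᵀ * (K * M⁻¹ * Kᵀ) * V) k k = 0 := by
        have : Vᵀ * (V * diagonal b * Vᵀ) * V = diagonal b := by
          calc _ = (Vᵀ * V) * diagonal b * (Vᵀ * V) := by simp only [Matrix.mul_assoc]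
            _ = _ := by rw [hV, Matrix.one_mul, Matrix.mul_one]
        rw [hNV, this, Matrix.diagonal_apply_eq, hbk]
      rw [Matrix.mul_assoc, Matrix.mul_apply] at h
      simpa [dotProduct, Matrix.mulVec, Matrix.mul_apply] using h
    have hKv : Kᵀ *ᵥ v = 0 := by
      by_contra hne
      have h := hM.inv.dotProduct_mulVec_pos hne
      rw [star_trivial, Matrix.mulVec_transpose, ← Matrix.dotProduct_mulVec,
        ← Matrix.mulVec_transpose, Matrix.mulVec_mulVec, Matrix.mulVec_mulVec, hNv] at h
      exact lt_irrefl _ h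
    have h1 : (diagonal a * Q) j k = 0 := by
      have h2 : diagonal a * Q = Uᵀ * (K * M₀⁻¹) * (Kᵀ * V) := by
        rw [hQ, ← Matrix.mul_assoc, ← hUN]; simp only [Matrix.mul_assoc]
      have h3 : ∀ i, (Kᵀ * V) i k = 0 := fun i => by
        simpa [Matrix.mul_apply, Matrix.mulVec, dotProduct, hv] using congrFun hKv i
      rw [h2, Matrix.mul_apply]
      exact Finset.sum_eq_zero fun i _ => by rw [h3, mul_zero]
    rwa [Matrix.diagonal_mul] at h1
  have htr : ∀ (O : Matrix κ κ ℝ) (e : κ → ℝ) (s : ℝ), Oᵀ * O = 1 →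
      (matrixRpow (O * diagonal e * Oᵀ) s).trace = ∑ i, e i ^ s := fun O e s hO => by
    rw [matrixRpow_orthogonal_conj hO, Matrix.trace_mul_comm, ← Matrix.mul_assoc, hO,
      Matrix.one_mul, Matrix.trace_diagonal]
  have htrD : (matrixRpow (K * M₀⁻¹ * Kᵀ) (p - 1) * (K * M₀⁻¹ * M * M₀⁻¹ * Kᵀ)).trace =
      ∑ j, a j ^ (p - 1) * D j j := by
    rw [hNU, matrixRpow_orthogonal_conj hU, Matrix.mul_assoc, Matrix.mul_assoc,
      Matrix.trace_mul_comm, Matrix.mul_assoc, ← hD, Matrix.trace]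
    exact Finset.sum_congr rfl fun j _ => by rw [Matrix.diag_apply, Matrix.diagonal_mul]
  rw [htrD] at hgrad
  rw [hNU, htr U a p hU] at hgrad ⊢
  rw [hNV, htr V b p hV]
  -- The tangent bound needs positive eigenvalues: if `a j = 0` the left side vanishes, and if only
  -- `b k = 0` then `hker` gives `Q j k = 0`.
  have hterm : ∀ j k, Q j k ^ 2 * a j ^ p +
      p * (Q j k ^ 2 * a j ^ p - a j ^ (p - 1) * (a j ^ 2 * (Q j k ^ 2 * (b k)⁻¹))) ≤
      Q j k ^ 2 * b k ^ p := by
    intro j k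
    rcases (ha j).eq_or_lt with h | h
    · rw [← h, Real.zero_rpow hp.ne']
      have := mul_nonneg (sq_nonneg (Q j k)) (Real.rpow_nonneg (hb k) p)
      simpa using this
    rcases (hb k).eq_or_lt with h' | h'
    · have hq : Q j k = 0 := (mul_eq_zero.1 (hker j k h'.symm)).resolve_left h.ne'
      simp [hq]
    · have := mul_le_mul_of_nonneg_left (rpow_tangent_le hp h h') (sq_nonneg (Q j k))
      linarith
  have hsum : ∑ j, ∑ k, (Q j k ^ 2 * a j ^ p +
      p * (Q j k ^ 2 * a j ^ p - a j ^ (p - 1) * (a j ^ 2 * (Q j k ^ 2 * (b k)⁻¹)))) ≤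
      ∑ j, ∑ k, Q j k ^ 2 * b k ^ p :=
    Finset.sum_le_sum fun j _ => Finset.sum_le_sum fun k _ => hterm j k
  have hr : ∑ j, ∑ k, Q j k ^ 2 * b k ^ p = ∑ k, b k ^ p := by
    rw [Finset.sum_comm]
    exact Finset.sum_congr rfl fun k _ => by rw [← Finset.sum_mul, hcol, one_mul]
  have hl : ∑ j, ∑ k, (Q j k ^ 2 * a j ^ p +
      p * (Q j k ^ 2 * a j ^ p - a j ^ (p - 1) * (a j ^ 2 * (Q j k ^ 2 * (b k)⁻¹)))) =
      ∑ j, a j ^ p + p * (∑ j, a j ^ p -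
        ∑ j, a j ^ (p - 1) * (a j ^ 2 * ∑ k, Q j k ^ 2 * (b k)⁻¹)) := by
    simp only [Finset.sum_add_distrib, ← Finset.mul_sum, Finset.sum_sub_distrib, ← Finset.sum_mul,
      hrow, one_mul]
  have hle : ∑ j, a j ^ (p - 1) * (a j ^ 2 * ∑ k, Q j k ^ 2 * (b k)⁻¹) ≤
      ∑ j, a j ^ (p - 1) * D j j :=
    Finset.sum_le_sum fun j _ =>
      mul_le_mul_of_nonneg_left (hdiagD j) (Real.rpow_nonneg (ha j) _)
  rw [hr, hl] at hsum
  nlinarith [mul_nonneg hp.le (sub_nonneg.2 (hle.trans hgrad))]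

/-- A linear inequality at `M₀` for `tr (A M₀⁻¹)` implies a global comparison. -/
theorem trace_mul_inv_le_of_gradient_le {ι : Type*} [Fintype ι] [DecidableEq ι]
    {M₀ M A : Matrix ι ι ℝ} (hM₀ : M₀.PosDef) (hM : M.PosDef) (hA : A.PosSemidef)
    (hgrad : (A * (M₀⁻¹ * M * M₀⁻¹)).trace ≤ (A * M₀⁻¹).trace) :
    (A * M₀⁻¹).trace ≤ (A * M⁻¹).trace := by
  have hMu : IsUnit M.det := isUnit_iff_ne_zero.2 hM.det_pos.ne'
  have hsymm : (M⁻¹ - M₀⁻¹)ᵀ = M⁻¹ - M₀⁻¹ := by simpa using (hM.inv.1.sub hM₀.inv.1).eq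
  have hE : ((M⁻¹ - M₀⁻¹) * M * (M⁻¹ - M₀⁻¹)).PosSemidef := by
    simpa [hsymm, -transpose_sub] using
      hM.posSemidef.conjTranspose_mul_mul_same (M⁻¹ - M₀⁻¹)
  have hexp : (M⁻¹ - M₀⁻¹) * M * (M⁻¹ - M₀⁻¹) = M⁻¹ - M₀⁻¹ - M₀⁻¹ + M₀⁻¹ * M * M₀⁻¹ := by
    rw [Matrix.sub_mul, Matrix.nonsing_inv_mul M hMu, Matrix.sub_mul, Matrix.one_mul,
      Matrix.mul_sub, Matrix.mul_assoc M₀⁻¹ M M⁻¹, Matrix.mul_nonsing_inv M hMu, Matrix.mul_one]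
    abel
  obtain ⟨U, e, hU, -, he, hAU⟩ := hA.exists_orthogonal_diagonalization
  have hnn : 0 ≤ (A * ((M⁻¹ - M₀⁻¹) * M * (M⁻¹ - M₀⁻¹))).trace := by
    have hG : (Uᵀ * ((M⁻¹ - M₀⁻¹) * M * (M⁻¹ - M₀⁻¹)) * U).PosSemidef := by
      simpa only [conjTranspose_eq_transpose_of_trivial] using hE.conjTranspose_mul_mul_same U
    rw [hAU, Matrix.mul_assoc, Matrix.mul_assoc, Matrix.trace_mul_comm, Matrix.mul_assoc,
      Matrix.trace]
    refine Finset.sum_nonneg fun i _ => ?_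
    rw [Matrix.diag_apply, Matrix.diagonal_mul]
    exact mul_nonneg (he i) hG.diag_nonneg
  rw [hexp, Matrix.mul_add, Matrix.mul_sub, Matrix.mul_sub, Matrix.trace_add, Matrix.trace_sub,
    Matrix.trace_sub] at hnn
  linarith

/-! ### Information matrices of feasible designs. -/

namespace GLModel

variable {d l n : ℕ} (M : GLModel d l)

theorem w_nonneg {y : Fin d → ℝ} (hy : y ∈ M.region) : 0 ≤ M.w y :=
  div_nonneg zero_le_one (mul_nonneg (M.variance_law_pos y hy).le (sq_nonneg _))

theorem posDef_fisherInfo {x : Fin n → Fin d → ℝ} (hx : ∀ i, x i ∈ M.region) {lam : Fin n → ℝ}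
    (hlam : lam ∈ M.feasibleWeights x) : (M.fisherInfo x lam).PosDef := by
  have hpsd : (M.fisherInfo x lam).PosSemidef := by
    refine posSemidef_sum _ fun i _ => PosSemidef.smul ?_
      (mul_nonneg (hlam.1.1 i) (M.w_nonneg (hx i)))
    simpa using posSemidef_vecMulVec_self_star (M.g (x i))
  exact hpsd.posDef_iff_det_ne_zero.2 hlam.2.ne_zero

theorem trace_mul_fisherInfo (C : Matrix (Fin l) (Fin l) ℝ) (x : Fin n → Fin d → ℝ)
    (lam : Fin n → ℝ) :
    (C * M.fisherInfo x lam).trace =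
      ∑ i, lam i * (M.w (x i) * (M.g (x i) ⬝ᵥ C *ᵥ M.g (x i))) := by
  rw [fisherInfo, Matrix.mul_sum, Matrix.trace_sum]
  refine Finset.sum_congr rfl fun i _ => ?_
  rw [Matrix.mul_smul, Matrix.trace_smul, Matrix.mul_vecMulVec, Matrix.trace_vecMulVec,
    dotProduct_comm, smul_eq_mul, mul_assoc]

/-- The trace is a weighted mean of the pointwise values, all equal to `t`; `lam` need not be the
design defining `C`. -/
theorem trace_mul_fisherInfo_of_forall_eq {C : Matrix (Fin l) (Fin l) ℝ}
    {x : Fin n → Fin d → ℝ} {lam : Fin n → ℝ} (hlam : lam ∈ M.feasibleWeights x) {t : ℝ}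
    (h : ∀ i, t = M.w (x i) * (M.g (x i) ⬝ᵥ C *ᵥ M.g (x i))) :
    (C * M.fisherInfo x lam).trace = t := by
  rw [trace_mul_fisherInfo]
  simp only [← h]
  rw [← Finset.sum_mul, hlam.1.2, one_mul]

theorem posSemidef_matA (ν : Measure (Fin d → ℝ))
    (hν : ∀ j k, IntegrableOn (fun y => M.c y j * M.c y k) M.region ν) :
    (M.matA ν).PosSemidef := by
  refine PosSemidef.of_dotProduct_mulVec_nonneg ?_ fun v => ?_
  · ext j k
    simp [matA, mul_comm]
  · have h : star v ⬝ᵥ M.matA ν *ᵥ v = ∫ y in M.region, (∑ j, v j * M.c y j) ^ 2 ∂ν := by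
      have hsq : ∀ y, (∑ j, v j * M.c y j) ^ 2 =
          ∑ j, ∑ k, v j * (M.c y j * M.c y k * v k) := fun y => by
        rw [sq, Finset.sum_mul_sum]
        exact Finset.sum_congr rfl fun j _ => Finset.sum_congr rfl fun k _ => by ring
      simp only [hsq]
      have hint : ∀ j k, Integrable (fun y => v j * (M.c y j * M.c y k * v k))
          (ν.restrict M.region) := fun j k => ((hν j k).mul_const (v k)).const_mul (v j)
      rw [integral_finsetSum _ fun j _ => integrable_finsetSum _ fun k _ => hint j k]
      simp only [dotProduct, Matrix.mulVec, star_trivial, matA, Matrix.of_apply]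
      refine Finset.sum_congr rfl fun j _ => ?_
      rw [integral_finsetSum _ fun k _ => hint j k, Finset.mul_sum]
      refine Finset.sum_congr rfl fun k _ => ?_
      rw [integral_const_mul, integral_mul_const]
    rw [h]
    exact integral_nonneg fun y => sq_nonneg _

end GLModel

/-! ### The optimality theorem. -/

theorem corollary2 {d l n : ℕ} (M : GLModel d l)
    (x : Fin n → Fin d → ℝ) (hx : ∀ i, x i ∈ M.region) (hinj : Function.Injective x)
    (lamStar : Fin n → ℝ) (hlam : lamStar ∈ M.feasibleWeights x) :
    (∀ (q : ℕ) (f : (Fin l → ℝ) → Fin q → ℝ) (p : ℝ), 0 < q → 0 < p →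
      DifferentiableAt ℝ f M.β →
      (∀ i, M.phi p f x lamStar =
        (q : ℝ) ^ (-1 / p) *
          (matrixRpow ((M.fisherInfo x lamStar)⁻¹ * M.matB f) p).trace ^ (1 / p - 1) *
          (M.w (x i) *
            (M.g (x i) ⬝ᵥ
              ((M.fisherInfo x lamStar)⁻¹ * M.matB f *
                matrixRpow ((M.fisherInfo x lamStar)⁻¹ * M.matB f) (p - 1) *
                (M.fisherInfo x lamStar)⁻¹) *ᵥ M.g (x i)))) →
      IsMinOn (M.phi p f x) (M.feasibleWeights x) lamStar) ∧
    (∀ (ν : Measure (Fin d → ℝ)) [IsProbabilityMeasure ν],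
      (∀ j k, IntegrableOn (fun y => M.c y j * M.c y k) M.region ν) →
      (∀ i, ((M.fisherInfo x lamStar)⁻¹ * M.matA ν).trace =
        M.w (x i) *
          (M.g (x i) ⬝ᵥ
            ((M.fisherInfo x lamStar)⁻¹ * M.matA ν * (M.fisherInfo x lamStar)⁻¹) *ᵥ
              M.g (x i))) →
      IsMinOn (M.EI ν x) (M.feasibleWeights x) lamStar) := by
  have hI := M.posDef_fisherInfo hx hlam
  constructor
  · intro q f p hq hp _ hcond lam hlam'
    have hI' := M.posDef_fisherInfo hx hlam'
    have hN : ((M.jacobian f) * (M.fisherInfo x lam)⁻¹ * (M.jacobian f)ᵀ).PosSemidef := by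
      simpa using hI'.inv.posSemidef.mul_mul_conjTranspose_same (M.jacobian f)
    have hN₀ : ((M.jacobian f) * (M.fisherInfo x lamStar)⁻¹ * (M.jacobian f)ᵀ).PosSemidef := by
      simpa using hI.inv.posSemidef.mul_mul_conjTranspose_same (M.jacobian f)
    have hT₀ := trace_matrixRpow_nonneg hN₀ p
    have hq' : (0 : ℝ) < q := by exact_mod_cast hq
    suffices hle : (matrixRpow
        (M.jacobian f * (M.fisherInfo x lamStar)⁻¹ * (M.jacobian f)ᵀ) p).trace ≤
        (matrixRpow (M.jacobian f * (M.fisherInfo x lam)⁻¹ * (M.jacobian f)ᵀ) p).trace from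
      Real.rpow_le_rpow (mul_nonneg (inv_nonneg.2 hq'.le) hT₀)
        (mul_le_mul_of_nonneg_left hle (inv_nonneg.2 hq'.le)) (by positivity)
    -- A zero trace is already minimal; otherwise the powers of the trace can be cancelled from the
    -- hypothesis.
    rcases hT₀.eq_or_lt with hT | hT
    · rw [← hT]
      exact trace_matrixRpow_nonneg hN p
    refine trace_matrixRpow_le_of_gradient_le hI hI' _ hp (le_of_eq ?_)
    have hcond' : ∀ i, (matrixRpow
        (M.jacobian f * (M.fisherInfo x lamStar)⁻¹ * (M.jacobian f)ᵀ) p).trace =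
        M.w (x i) * (M.g (x i) ⬝ᵥ
          ((M.fisherInfo x lamStar)⁻¹ * (M.jacobian f)ᵀ * matrixRpow
            (M.jacobian f * (M.fisherInfo x lamStar)⁻¹ * (M.jacobian f)ᵀ) (p - 1) *
            M.jacobian f * (M.fisherInfo x lamStar)⁻¹) *ᵥ M.g (x i)) := by
      intro i
      have h := hcond i
      rw [GLModel.matB, posDef_mul_matrixRpow_mul hI.inv,
        trace_matrixRpow_posDef_mul hI.inv _ hp.ne', GLModel.phi,
        Real.mul_rpow (inv_nonneg.2 hq'.le) hT.le, Real.inv_rpow hq'.le, ← Real.rpow_neg hq'.le,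
        ← neg_div, mul_assoc] at h
      have h1 := mul_left_cancel₀ (Real.rpow_pos_of_pos hq' _).ne' h
      -- Writing `T^(1/p - 1) = T^(1/p) / T` and cancelling `T^(1/p)` leaves the condition linear in
      -- `T`.
      rw [Real.rpow_sub_one hT.ne', div_mul_eq_mul_div, mul_div_assoc] at h1
      have h2 := mul_left_cancel₀ (Real.rpow_pos_of_pos hT _).ne'
        ((mul_one _).trans h1)
      rw [eq_div_iff hT.ne', one_mul] at h2
      exact h2
    rw [← M.trace_mul_fisherInfo_of_forall_eq hlam' hcond']
    exact trace_mul_gradient_comm _ _ _ _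
  · intro ν _ hν hcond lam hlam'
    refine trace_mul_inv_le_of_gradient_le hI (M.posDef_fisherInfo hx hlam')
      (M.posSemidef_matA ν hν) (le_of_eq ?_)
    rw [Matrix.trace_mul_comm (M.matA ν), Matrix.trace_mul_comm (M.matA ν),
      ← M.trace_mul_fisherInfo_of_forall_eq hlam' hcond, Matrix.mul_assoc, Matrix.mul_assoc,
      Matrix.trace_mul_comm, Matrix.mul_assoc, Matrix.trace_mul_comm]
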